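/- Let $N\ge 1$, $\mathbf c\in\mathbb R^N$, $\gamma>0$, and let $\lambda_1,\dots,\lambda_N>0$ be fixed, with minimum $\lambda_{\min}$, maximum $\lambda_{\max}$, mean $\overline\lambda=\frac1N\sum_n\lambda_n$ and variance $v=\frac1N\sum_n(\lambda_n-\overline\lambda)^2$. Let $\mathbf Q=\mathbf V\,\mathrm{diag}(\lambda_1,\dots,\lambda_N)\,\mathbf V^T$, where $\mathbf V$ is drawn uniformly at random (Haar measure) from the $N\times N$ orthogonal matrices. Let $K^*$ be the maximum number of zero components of a vector $\mathbf x$ with $(\mathbf x-\mathbf c)^T\mathbf Q(\mathbf x-\mathbf c)\le\gamma$. Let $K_d$ be the corresponding number for the tightest diagonal relaxation, i.e. the minimum, over all diagonal $\mathbf D$ with $\mathbf 0\preceq\mathbf D\preceq\mathbf Q$, of the maximum number of zero components of a vector $\mathbf x$ with $(\mathbf x-\mathbf c)^T\mathbf D(\mathbf x-\mathbf c)\le\gamma$. Let $S_K$ be the sum of the $K$ smallest of the numbers $c_1^2,\dots,c_N^2$. For $\epsilon>0$ put $$\underline K=\max\{K\in\{0,\dots,N\}:(1+\epsilon)\,\overline\lambda\,S_K\le\gamma\},\qquad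 r=(1+\epsilon)\,\overline\lambda/\lambda_{\min}.$$ Then, with probability at least $$\begin{cases}1-\exp\left(-\frac N8\,\frac{\epsilon^2\overline\lambda^2}{\epsilon^2\overline\lambda^2+v}\right),&\epsilon\in(0,\epsilon_{\max})\setminus\mathcal I,\\ 1-\exp\left(-\frac N8\,\frac{\epsilon\overline\lambda}{\epsilon\overline\lambda+(\lambda_{\max}-\overline\lambda)}\right),&\epsilon\in\mathcal I,\\ 1,&\epsilon\ge\epsilon_{\max},\end{cases}$$ the following holds: if $\underline K\ge1$, then $K^*\ge1$ and $$\frac{K_d}{K^*}\le\frac{\lceil(\underline K+1)\,r\rceil-1}{\underline K}.$$ Here $\epsilon_{\max}=\lambda_{\max}/\overline\lambda-1$; $\mathcal I=(\epsilon_-,\epsilon_+)$ if $(\lambda_{\max}-\overline\lambda)^2>8v$ and $\mathcal I=\emptyset$ otherwise; and $\epsilon_\pm=\frac14\left(\epsilon_{\max}\pm\sqrt{\epsilon_{\max}^2-8v/\overline\lambda^2}\right)$. On the same event the following also holds for $\underline K'=\max\{K\in\{0,\dots,N\}:\lambda_{\max}(\mathbf Q/\mathbf Q_{Y(K)Y(K)})\,S_K\le\gamma\}$,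 where $Z(K)$ is the set of the first $K$ indices in a fixed enumeration of $\{1,\dots,N\}$ by nondecreasing $|c_n|$, $Y(K)$ is its complement, and $\mathbf Q/\mathbf Q_{YY}=\mathbf Q_{ZZ}-\mathbf Q_{ZY}\mathbf Q_{YY}^{-1}\mathbf Q_{YZ}$ is the Schur complement: if $\underline K'\ge1$, then $K^*\ge1$, $\;K_d/K^*<(\underline K'+1)\,r/\underline K'$, and, whenever $\underline K'\ge\underline K$ (which is always the case for $\epsilon\ge\epsilon_{\max}$), $\;K_d/K^*\le(\lceil(\underline K'+1)\,r\rceil-1)/\underline K'$. -/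

import Mathlib

open MeasureTheory

noncomputable section

namespace SparseQuad

/-- The constraint `(x - c)ᵀ Q (x - c) ≤ γ`: the point `x` lies in the (possibly degenerate)
ellipsoid determined by `Q`, `c` and `γ`. -/
def Feasible {N : ℕ} (Q : Matrix (Fin N) (Fin N) ℝ) (c : Fin N → ℝ) (γ : ℝ)
    (x : Fin N → ℝ) : Prop :=
  (x - c) ⬝ᵥ (Q.mulVec (x - c)) ≤ γ

/-- The number of zero-valued components of `x`, that is `N` minus its cardinality. -/
def numZeros {N : ℕ} (x : Fin N → ℝ) : ℕ :=
  (Finset.univ.filter fun n => x n = 0).card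

/-- The maximum number of zero-valued components of a feasible point of the problem
"minimize the number of nonzero components of `x` subject to `(x - c)ᵀ Q (x - c) ≤ γ`".
For the original matrix `Q` this is `K*`. -/
def maxZeros {N : ℕ} (Q : Matrix (Fin N) (Fin N) ℝ) (c : Fin N → ℝ) (γ : ℝ) : ℕ :=
  sSup {k : ℕ | ∃ x : Fin N → ℝ, Feasible Q c γ x ∧ numZeros x = k}

/-- `K_d`: the maximum number of zero-valued components in the tightest diagonal relaxation.
Every diagonal `D` with `0 ⪯ D ⪯ Q` gives a relaxation; the tightest one has the largest minimum
cardinality, that is the smallest maximum number of zeros. -/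
def diagMaxZeros {N : ℕ} (Q : Matrix (Fin N) (Fin N) ℝ) (c : Fin N → ℝ) (γ : ℝ) : ℕ :=
  sInf {k : ℕ | ∃ D : Matrix (Fin N) (Fin N) ℝ,
    D.IsDiag ∧ D.PosSemidef ∧ (Q - D).PosSemidef ∧ maxZeros D c γ = k}

/-- `S_K({a_n})`: the sum of the `K` smallest elements of the sequence `a` (for `K ≤ N`). -/
def sumSmallest {N : ℕ} (K : ℕ) (a : Fin N → ℝ) : ℝ :=
  ∑ i : Fin N, if (i : ℕ) < K then a (Tuple.sort a i) else 0

/-- The Schur complement `Q / Q_YY = Q_ZZ - Q_ZY (Q_YY)⁻¹ Q_YZ`, where `Y` is the complement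
of the set of indices `Z`. -/
def schurCompl {N : ℕ} (Q : Matrix (Fin N) (Fin N) ℝ) (Z : Finset (Fin N)) :
    Matrix {n // n ∈ Z} {n // n ∈ Z} ℝ :=
  Q.submatrix (fun n => n.1) (fun n => n.1) -
    Q.submatrix (fun n : {n // n ∈ Z} => n.1) (fun n : {n // n ∉ Z} => n.1) *
      (Q.submatrix (fun n : {n // n ∉ Z} => n.1) (fun n : {n // n ∉ Z} => n.1))⁻¹ *
        Q.submatrix (fun n : {n // n ∉ Z} => n.1) (fun n : {n // n ∈ Z} => n.1)

/-- The largest (real) eigenvalue of a symmetric matrix. -/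
def lambdaMax {m : Type} [Fintype m] [DecidableEq m] (A : Matrix m m ℝ) : ℝ :=
  sSup (spectrum ℝ A)

/-- `Z(K)`: the first `K` indices in the enumeration `σ` of all indices; it is used for
enumerations `σ` by nondecreasing magnitude of the components of `c`. -/
def firstIdx {N : ℕ} (σ : Equiv.Perm (Fin N)) (K : ℕ) : Finset (Fin N) :=
  (Finset.univ.filter fun i : Fin N => (i : ℕ) < K).image σ

/-- The largest `K ∈ {0, …, N}` with `λ_max(Q / Q_{Y(K)Y(K)}) · S_K({c_n²}) ≤ γ`, where the
complement `Z(K)` of `Y(K)` consists of the first `K` indices in the enumeration `σ`. -/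
def schurK {N : ℕ} (Q : Matrix (Fin N) (Fin N) ℝ) (c : Fin N → ℝ) (γ : ℝ)
    (σ : Equiv.Perm (Fin N)) : ℕ :=
  sSup {K : ℕ | K ≤ N ∧
    lambdaMax (schurCompl Q (firstIdx σ K)) * sumSmallest K (fun n => c n ^ 2) ≤ γ}

/-- The smallest element of the spectrum `lam`. -/
def eigMin {N : ℕ} (lam : Fin N → ℝ) : ℝ := ⨅ n, lam n

/-- The largest element of the spectrum `lam`. -/
def eigMax {N : ℕ} (lam : Fin N → ℝ) : ℝ := ⨆ n, lam n

/-- The mean eigenvalue. -/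
def eigMean {N : ℕ} (lam : Fin N → ℝ) : ℝ := (1 / (N : ℝ)) * ∑ n, lam n

/-- The variance of the eigenvalues. -/
def eigVar {N : ℕ} (lam : Fin N → ℝ) : ℝ :=
  (1 / (N : ℝ)) * ∑ n, (lam n - eigMean lam) ^ 2

/-- The largest `K ∈ {0, …, N}` with `(1 + ε) · mean(lam) · S_K({c_n²}) ≤ γ`. -/
def meanK {N : ℕ} (lam : Fin N → ℝ) (c : Fin N → ℝ) (γ ε : ℝ) : ℕ :=
  sSup {K : ℕ | K ≤ N ∧
    (1 + ε) * eigMean lam * sumSmallest K (fun n => c n ^ 2) ≤ γ}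

/-- `ε_max = λ_max / mean - 1`. -/
def epsMax {N : ℕ} (lam : Fin N → ℝ) : ℝ := eigMax lam / eigMean lam - 1

/-- `ε_- = (ε_max - √(ε_max² - 8 var / mean²)) / 4`. -/
def epsMinus {N : ℕ} (lam : Fin N → ℝ) : ℝ :=
  (1 / 4) * (epsMax lam - Real.sqrt (epsMax lam ^ 2 - 8 * (eigVar lam / eigMean lam ^ 2)))

/-- `ε_+ = (ε_max + √(ε_max² - 8 var / mean²)) / 4`. -/
def epsPlus {N : ℕ} (lam : Fin N → ℝ) : ℝ :=
  (1 / 4) * (epsMax lam + Real.sqrt (epsMax lam ^ 2 - 8 * (eigVar lam / eigMean lam ^ 2)))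

open Classical in
/-- The interval `𝓘`. -/
def epsInterval {N : ℕ} (lam : Fin N → ℝ) : Set ℝ :=
  if 8 * eigVar lam < (eigMax lam - eigMean lam) ^ 2 then
    Set.Ioo (epsMinus lam) (epsPlus lam)
  else ∅

open Classical in
/-- The guaranteed probability, as a function of `ε > 0`. -/
def probBound {N : ℕ} (lam : Fin N → ℝ) (ε : ℝ) : ℝ :=
  if epsMax lam ≤ ε then 1
  else if ε ∈ epsInterval lam then
    1 - Real.exp (-((N : ℝ) / 8 *
      (ε * eigMean lam / (ε * eigMean lam + (eigMax lam - eigMean lam)))))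
  else
    1 - Real.exp (-((N : ℝ) / 8 *
      (ε ^ 2 * eigMean lam ^ 2 / (ε ^ 2 * eigMean lam ^ 2 + eigVar lam))))

/-- The right-hand side `(⌈(K + 1)(1 + ε) mean / λ_min⌉ - 1) / K` of the bound on the
approximation ratio (meaningful for `K ≥ 1`). -/
def ratioBound {N : ℕ} (lam : Fin N → ℝ) (ε : ℝ) (K : ℕ) : ℝ :=
  (((⌈((K : ℝ) + 1) * (1 + ε) * eigMean lam / eigMin lam⌉ : ℤ) : ℝ) - 1) / (K : ℝ)

/-- The random matrix `V` is uniformly distributed on the orthogonal group: it is measurable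
and orthogonal, and its law is invariant under left multiplication by any fixed orthogonal matrix.
The Haar probability measure is the only law with this property. -/
structure IsHaarOrthogonal {N : ℕ} {Ω : Type*} [MeasurableSpace Ω] (P : Measure Ω)
    (V : Ω → Matrix (Fin N) (Fin N) ℝ) : Prop where
  mem : ∀ ω, V ω ∈ Matrix.orthogonalGroup (Fin N) ℝ
  measurable : ∀ i j, Measurable fun ω => V ω i j
  invariant : ∀ U ∈ Matrix.orthogonalGroup (Fin N) ℝ,
    P.map (fun ω => fun i j : Fin N => (U * V ω) i j) =
      P.map (fun ω => fun i j : Fin N => V ω i j)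

/-- The matrix `Q = V Λ Vᵀ` with eigenvector matrix `V` (eigenvectors are the columns) and
eigenvalues `lam`. -/
def ofEigen {N : ℕ} (V : Matrix (Fin N) (Fin N) ℝ) (lam : Fin N → ℝ) :
    Matrix (Fin N) (Fin N) ℝ :=
  V * Matrix.diagonal lam * V.transpose

end SparseQuad

end

/-!
The bounds hold on a single event. Write `K = meanK lam c γ ε` (a deterministic number) and let
`u` agree with `c` on its `K` components of smallest magnitude and vanish elsewhere. The event is
`uᵀ Q u ≤ (1 + ε) · mean · ‖u‖²`.

*On the event the bounds are deterministic* (`ratio_bounds`). The point `c - u` has `K` zeros and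
cost `uᵀ Q u ≤ (1 + ε) · mean · S_K ≤ γ`, so `K* ≥ K`. Minimizing the cost over the components
outside `Z(K')` turns `Q` into its Schur complement, so `K* ≥ K'` as well, on every outcome. For
the relaxation, `D = λ_min · I` is admissible; as the average of the `k` smallest `c_n²` is
nondecreasing in `k`, and `(1 + ε) · mean · S_{K+1} > γ`, no point of that relaxation has
`(K + 1) (1 + ε) · mean / λ_min` zeros or more. Hence `K_d < (K + 1) r`. When
`K' < K`, the strict bound in terms of `K'` follows from `K_d / K* < (K + 1) r / K` and
`(K + 1) / K ≤ (K' + 1) / K'`.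

*The event has the required probability* (`probBound_le_measureReal`). It fails exactly when
`∑ aₙ (Vᵀ u)ₙ² > 0`, where `aₙ = λₙ - (1 + ε) · mean`. By invariance of the law of `V`, the
probability of this does not depend on `u ≠ 0`; averaging over a standard Gaussian `u`, and using
rotation invariance of the Gaussian for each fixed `V`, shows that it equals the probability of
`∑ aₙ gₙ² > 0` for independent standard Gaussians `gₙ`. The Chernoff bound with
`𝔼 exp (s g²) = (1 - 2s)^(-1/2) ≤ exp (s + 2s²)`, valid for `s ≤ 1/4`, bounds this by
`exp (N (-t ε mean + 2 t² (ε² mean² + var)))` for `0 ≤ t ≤ 1 / (4 max aₙ)`. The interval `𝓘` is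
exactly the set of those `ε` for which the unconstrained optimal `t` is not allowed.
-/

namespace SparseQuad

open Matrix ProbabilityTheory

variable {N : ℕ}

/-! ### Sums of the smallest elements -/

lemma card_firstIdx (σ : Equiv.Perm (Fin N)) {K : ℕ} (hK : K ≤ N) : (firstIdx σ K).card = K := by
  rw [firstIdx, Finset.card_image_of_injective _ σ.injective, Fin.card_filter_val_lt,
    min_eq_right hK]

lemma sumSmallest_eq_sum_firstIdx {a : Fin N → ℝ} {σ : Equiv.Perm (Fin N)}
    (hσ : Monotone (a ∘ σ)) (K : ℕ) : sumSmallest K a = ∑ n ∈ firstIdx σ K, a n := by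
  have h := Tuple.unique_monotone (Tuple.monotone_sort a) hσ
  rw [firstIdx, Finset.sum_image σ.injective.injOn, Finset.sum_filter, sumSmallest]
  exact Finset.sum_congr rfl fun i _ => by rw [show a (Tuple.sort a i) = a (σ i) from congrFun h i]

/-- The average of the `m` smallest elements is at most the average over any set of at least `m`
indices. -/
lemma card_mul_sumSmallest_le (a : Fin N → ℝ) (Z : Finset (Fin N)) {m : ℕ} (hm : m ≤ Z.card) :
    (Z.card : ℝ) * sumSmallest m a ≤ m * ∑ n ∈ Z, a n := by
  have hN : m ≤ N := hm.trans (card_finset_fin_le Z)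
  rcases Nat.eq_zero_or_pos m with rfl | hm0
  · simp [sumSmallest]
  rw [sumSmallest_eq_sum_firstIdx (Tuple.monotone_sort a)]
  set σ := Tuple.sort a with hσ
  have hmono : Monotone (a ∘ σ) := Tuple.monotone_sort a
  set M := firstIdx σ m with hM
  have hcard : M.card = m := card_firstIdx σ hN
  -- A threshold separating the `m` smallest elements from the others: the largest of the former.
  let τ : ℝ := a (σ ⟨m - 1, by omega⟩)
  have hin : ∀ n ∈ M, a n - τ ≤ 0 := by
    intro n hn
    obtain ⟨i, hi, rfl⟩ := Finset.mem_image.1 hn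
    have hi' : (i : ℕ) < m := (Finset.mem_filter.1 hi).2
    have := hmono (show i ≤ ⟨m - 1, by omega⟩ from Fin.mk_le_mk.2 (by omega))
    simpa [τ] using this
  have hout : ∀ n, n ∉ M → 0 ≤ a n - τ := by
    intro n hn
    have hi' : ¬ ((σ.symm n : Fin N) : ℕ) < m := fun h =>
      hn (Finset.mem_image.2 ⟨σ.symm n, by simpa using h, by simp⟩)
    have hle : m - 1 ≤ (σ.symm n : ℕ) := by
      rw [not_lt] at hi'
      exact (Nat.sub_le m 1).trans hi'
    have := hmono (show (⟨m - 1, by omega⟩ : Fin N) ≤ σ.symm n from hle)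
    simpa [τ] using this
  have h1 : ∑ n ∈ Z ∩ M, (a n - τ) ≤ ∑ n ∈ Z, (a n - τ) :=
    Finset.sum_le_sum_of_subset_of_nonneg Finset.inter_subset_left fun n hn hn' =>
      hout n fun h => hn' (Finset.mem_inter.2 ⟨hn, h⟩)
  have h2 : ∑ n ∈ M, (a n - τ) ≤ ∑ n ∈ Z ∩ M, (a n - τ) := by
    rw [← Finset.sum_sdiff (Finset.inter_subset_right : Z ∩ M ⊆ M)]
    have := Finset.sum_nonpos fun n (hn : n ∈ M \ (Z ∩ M)) => hin n (Finset.mem_sdiff.1 hn).1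
    linarith
  have h3 : ∑ n ∈ Z ∩ M, (a n - τ) ≤ 0 :=
    Finset.sum_nonpos fun n hn => hin n (Finset.mem_inter.1 hn).2
  have hmk : (m : ℝ) ≤ Z.card := by exact_mod_cast hm
  have hm' : (0 : ℝ) ≤ m := Nat.cast_nonneg m
  have key : (Z.card : ℝ) * ∑ n ∈ M, (a n - τ) ≤ m * ∑ n ∈ Z, (a n - τ) :=
    calc _ ≤ (Z.card : ℝ) * ∑ n ∈ Z ∩ M, (a n - τ) :=
          mul_le_mul_of_nonneg_left h2 (hm'.trans hmk)
      _ ≤ m * ∑ n ∈ Z ∩ M, (a n - τ) := mul_le_mul_of_nonpos_right hmk h3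
      _ ≤ _ := mul_le_mul_of_nonneg_left h1 hm'
  simp only [Finset.sum_sub_distrib, Finset.sum_const, hcard, nsmul_eq_mul] at key
  linarith

/-! ### Numbers of zeros of feasible points -/

lemma numZeros_le (x : Fin N → ℝ) : numZeros x ≤ N := card_finset_fin_le _

lemma bddAbove_numZeros_feasible (Q : Matrix (Fin N) (Fin N) ℝ) (c : Fin N → ℝ) (γ : ℝ) :
    BddAbove {k : ℕ | ∃ x : Fin N → ℝ, Feasible Q c γ x ∧ numZeros x = k} :=
  ⟨N, by rintro _ ⟨x, -, rfl⟩; exact numZeros_le x⟩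

lemma numZeros_le_maxZeros {Q : Matrix (Fin N) (Fin N) ℝ} {c : Fin N → ℝ} {γ : ℝ}
    {x : Fin N → ℝ} (hx : Feasible Q c γ x) : numZeros x ≤ maxZeros Q c γ :=
  le_csSup (bddAbove_numZeros_feasible Q c γ) ⟨x, hx, rfl⟩

lemma exists_numZeros_eq_maxZeros (Q : Matrix (Fin N) (Fin N) ℝ) (c : Fin N → ℝ) {γ : ℝ}
    (hγ : 0 ≤ γ) : ∃ x, Feasible Q c γ x ∧ numZeros x = maxZeros Q c γ :=
  Nat.sSup_mem (s := {k : ℕ | ∃ x : Fin N → ℝ, Feasible Q c γ x ∧ numZeros x = k})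
    ⟨_, c, by simpa [Feasible] using hγ, rfl⟩ (bddAbove_numZeros_feasible Q c γ)

lemma card_le_maxZeros {Q : Matrix (Fin N) (Fin N) ℝ} {c : Fin N → ℝ} {γ : ℝ}
    {x : Fin N → ℝ} (hx : Feasible Q c γ x) {Z : Finset (Fin N)} (hZ : ∀ n ∈ Z, x n = 0) :
    Z.card ≤ maxZeros Q c γ :=
  (Finset.card_le_card fun n hn => by simpa using hZ n hn).trans (numZeros_le_maxZeros hx)

/-- The relaxation bound for the scaled identity: if `q · S_{K+1} > γ` for some `q ≥ μ`, then no
point of the ball `μ ‖x - c‖² ≤ γ` has `(K + 1) q / μ` zeros or more. When `K ≥ N` nothing is needed,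
since `(K + 1) q / μ > N`. -/
lemma maxZeros_diagonal_const_lt {c : Fin N → ℝ} {γ μ q : ℝ} (hγ : 0 ≤ γ) (hμ : 0 < μ) (hq : μ ≤ q)
    {K : ℕ} (hK : K < N → γ < q * sumSmallest (K + 1) fun n => c n ^ 2) :
    (maxZeros (diagonal fun _ : Fin N => μ) c γ : ℝ) < ((K : ℝ) + 1) * q / μ := by
  obtain ⟨x, hx, hxk⟩ := exists_numZeros_eq_maxZeros (diagonal fun _ : Fin N => μ) c hγ
  rw [← hxk, lt_div_iff₀ hμ]
  by_contra! hlt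
  set Z := Finset.univ.filter fun n => x n = 0 with hZ
  have hnum : numZeros x = Z.card := rfl
  rw [hnum] at hlt
  have hKZ : K + 1 ≤ Z.card := by
    have : ((K : ℝ) + 1) * μ ≤ Z.card * μ :=
      (mul_le_mul_of_nonneg_left hq (by positivity)).trans hlt
    exact_mod_cast le_of_mul_le_mul_right this hμ
  have hS := hK (hKZ.trans (card_finset_fin_le Z))
  set S := sumSmallest (K + 1) fun n => c n ^ 2
  have hS0 : 0 < S := pos_of_mul_pos_right (hγ.trans_lt hS) (hμ.le.trans hq)
  have hsum : μ * ∑ n ∈ Z, c n ^ 2 ≤ γ := by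
    refine le_trans ?_ hx
    have : (x - c) ⬝ᵥ ((diagonal fun _ : Fin N => μ).mulVec (x - c)) =
        μ * ∑ n, (x n - c n) ^ 2 := by
      simp only [dotProduct, mulVec_diagonal, Pi.sub_apply, Finset.mul_sum]
      exact Finset.sum_congr rfl fun n _ => by ring
    rw [this]
    refine mul_le_mul_of_nonneg_left ?_ hμ.le
    calc ∑ n ∈ Z, c n ^ 2 = ∑ n ∈ Z, (x n - c n) ^ 2 :=
          Finset.sum_congr rfl fun n hn => by rw [(Finset.mem_filter.1 hn).2]; ring
      _ ≤ _ := Finset.sum_le_univ_sum_of_nonneg fun n => sq_nonneg _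
  have havg := card_mul_sumSmallest_le (fun n => c n ^ 2) Z hKZ
  push_cast at havg
  have h1 : ((K : ℝ) + 1) * q * S ≤ Z.card * μ * S := mul_le_mul_of_nonneg_right hlt hS0.le
  have h2 := mul_le_mul_of_nonneg_left havg hμ.le
  have h3 : ((K : ℝ) + 1) * (μ * ∑ n ∈ Z, c n ^ 2) ≤ (K + 1) * γ :=
    mul_le_mul_of_nonneg_left hsum (by positivity)
  have h4 : ((K : ℝ) + 1) * γ < (K + 1) * (q * S) :=
    mul_lt_mul_of_pos_left hS (by positivity)
  nlinarith

/-! ### The spectrum and the matrix `V Λ Vᵀ` -/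

lemma eigMin_le (lam : Fin N → ℝ) (n : Fin N) : eigMin lam ≤ lam n :=
  ciInf_le (Set.finite_range lam).bddBelow n

lemma le_eigMax (lam : Fin N → ℝ) (n : Fin N) : lam n ≤ eigMax lam :=
  le_ciSup (Set.finite_range lam).bddAbove n

lemma eigMin_pos (hN : 0 < N) {lam : Fin N → ℝ} (hlam : ∀ n, 0 < lam n) : 0 < eigMin lam := by
  have : Nonempty (Fin N) := ⟨⟨0, hN⟩⟩
  obtain ⟨n, hn⟩ := exists_eq_ciInf_of_finite (f := lam)
  rw [eigMin, ← hn]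
  exact hlam n

lemma sum_eq_card_mul_eigMean (hN : 0 < N) (lam : Fin N → ℝ) :
    ∑ n, lam n = N * eigMean lam := by
  rw [eigMean]; field_simp

lemma eigMin_le_eigMean (hN : 0 < N) (lam : Fin N → ℝ) : eigMin lam ≤ eigMean lam := by
  have h : ∑ _n : Fin N, eigMin lam ≤ ∑ n, lam n := Finset.sum_le_sum fun n _ => eigMin_le lam n
  rw [sum_eq_card_mul_eigMean hN lam, Finset.sum_const, Finset.card_fin, nsmul_eq_mul] at h
  exact le_of_mul_le_mul_left h (by exact_mod_cast hN)

lemma ofEigen_quadForm (V : Matrix (Fin N) (Fin N) ℝ) (lam u : Fin N → ℝ) :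
    u ⬝ᵥ (ofEigen V lam).mulVec u = ∑ n, lam n * (Vᵀ.mulVec u) n ^ 2 := by
  rw [ofEigen, ← mulVec_mulVec, ← mulVec_mulVec, dotProduct_mulVec, ← mulVec_transpose]
  simp only [dotProduct, mulVec_diagonal]
  exact Finset.sum_congr rfl fun n _ => by ring

lemma sum_sq_transpose_mulVec {V : Matrix (Fin N) (Fin N) ℝ}
    (hV : V ∈ orthogonalGroup (Fin N) ℝ) (u : Fin N → ℝ) :
    ∑ n, (Vᵀ.mulVec u) n ^ 2 = ∑ n, u n ^ 2 := by
  have h := ofEigen_quadForm V 1 u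
  have hV' : V * Vᵀ = 1 := (mem_orthogonalGroup_iff (Fin N) ℝ).1 hV
  have h1 : ofEigen V 1 = 1 := by
    rw [ofEigen, show diagonal (1 : Fin N → ℝ) = 1 from diagonal_one, Matrix.mul_one, hV']
  rw [h1, one_mulVec] at h
  simpa [dotProduct, sq] using h.symm

lemma posDef_ofEigen {V : Matrix (Fin N) (Fin N) ℝ} (hV : V ∈ orthogonalGroup (Fin N) ℝ)
    {lam : Fin N → ℝ} (hlam : ∀ n, 0 < lam n) : (ofEigen V lam).PosDef := by
  have hV' : V * Vᵀ = 1 := (mem_orthogonalGroup_iff (Fin N) ℝ).1 hV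
  have := (PosDef.diagonal hlam).mul_mul_conjTranspose_same (B := V) ?_
  · simpa [ofEigen, conjTranspose_eq_transpose_of_trivial] using this
  · exact (vecMul_injective_iff_isUnit).2 (IsUnit.of_mul_eq_one _ hV')

lemma diagMaxZeros_le {V : Matrix (Fin N) (Fin N) ℝ} (hV : V ∈ orthogonalGroup (Fin N) ℝ)
    (hN : 0 < N) {lam : Fin N → ℝ} (hlam : ∀ n, 0 < lam n) (c : Fin N → ℝ) (γ : ℝ) :
    diagMaxZeros (ofEigen V lam) c γ ≤ maxZeros (diagonal fun _ => eigMin lam) c γ := by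
  have hV' : V * Vᵀ = 1 := (mem_orthogonalGroup_iff (Fin N) ℝ).1 hV
  refine Nat.sInf_le ⟨_, isDiag_diagonal _, PosSemidef.diagonal fun _ => (eigMin_pos hN hlam).le,
    ?_, rfl⟩
  have h : ofEigen V lam - diagonal (fun _ => eigMin lam) =
      V * diagonal (fun n => lam n - eigMin lam) * Vᴴ := by
    rw [conjTranspose_eq_transpose_of_trivial, ofEigen, ← diagonal_sub, Matrix.mul_sub,
      Matrix.sub_mul]
    congr 1
    rw [← smul_one_eq_diagonal, Matrix.mul_smul, Matrix.mul_one, Matrix.smul_mul, hV']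
  rw [h]
  exact (PosSemidef.diagonal fun n => sub_nonneg.2 (eigMin_le lam n)).mul_mul_conjTranspose_same V

/-! ### Lower bounds on the number of zeros -/

lemma dotProduct_mulVec_le_lambdaMax {m : Type} [Fintype m] [DecidableEq m] {A : Matrix m m ℝ}
    (hA : A.IsHermitian) (x : m → ℝ) : x ⬝ᵥ A.mulVec x ≤ lambdaMax A * (x ⬝ᵥ x) := by
  have hps : (algebraMap ℝ (Matrix m m ℝ) (lambdaMax A) - A).PosSemidef := by
    rw [posSemidef_iff_isHermitian_and_spectrum_nonneg]
    refine ⟨IsHermitian.sub ?_ hA, ?_⟩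
    · rw [algebraMap_eq_diagonal]
      exact isHermitian_diagonal _
    · rw [← spectrum.singleton_sub_eq]
      rintro _ ⟨_, rfl, s, hs, rfl⟩
      exact sub_nonneg.2 (le_csSup A.finite_real_spectrum.bddAbove hs)
  have h := hps.dotProduct_mulVec_nonneg x
  rw [sub_mulVec, dotProduct_sub, Algebra.algebraMap_eq_smul_one, smul_mulVec, one_mulVec,
    dotProduct_smul, star_trivial, smul_eq_mul] at h
  linarith

/-- Setting the components in `Z` to zero and choosing the others optimally costs
`c_Zᵀ (Q / Q_YY) c_Z`, which is at most `λ_max(Q / Q_YY) ‖c_Z‖²`. -/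
lemma exists_feasible_schurCompl {Q : Matrix (Fin N) (Fin N) ℝ} (hQ : Q.PosDef)
    (Z : Finset (Fin N)) (c : Fin N → ℝ) {γ : ℝ}
    (h : lambdaMax (schurCompl Q Z) * ∑ n ∈ Z, c n ^ 2 ≤ γ) :
    ∃ x, Feasible Q c γ x ∧ ∀ n ∈ Z, x n = 0 := by
  set A := Q.submatrix (fun n : {n // n ∈ Z} => n.1) (fun n : {n // n ∈ Z} => n.1) with hA
  set B := Q.submatrix (fun n : {n // n ∈ Z} => n.1) (fun n : {n // n ∉ Z} => n.1) with hB
  set D := Q.submatrix (fun n : {n // n ∉ Z} => n.1) (fun n : {n // n ∉ Z} => n.1) with hD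
  have hsym : ∀ i j, Q i j = Q j i := fun i j => by simpa using hQ.1.apply j i
  have hBt : Q.submatrix (fun n : {n // n ∉ Z} => n.1) (fun n : {n // n ∈ Z} => n.1) = Bᴴ := by
    ext i j; simp [hB, hsym]
  have hDpos : D.PosDef := hQ.submatrix Subtype.val_injective
  have hApos : A.IsHermitian := (hQ.submatrix Subtype.val_injective).1
  have hS : schurCompl Q Z = A - B * D⁻¹ * Bᴴ := by rw [schurCompl, hBt]
  have hSh : (schurCompl Q Z).IsHermitian := by
    rw [hS]
    exact hApos.sub (isHermitian_mul_mul_conjTranspose B hDpos.1.inv)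
  let := hDpos.isUnit.invertible
  let u : {n // n ∈ Z} → ℝ := fun n => -c n
  -- The minimizer over the free components: it annihilates the square completed in
  -- `schur_complement_eq₂₂`.
  let y : {n // n ∉ Z} → ℝ := -((D⁻¹ * Bᴴ).mulVec u)
  let e : {n // n ∈ Z} ⊕ {n // n ∉ Z} ≃ Fin N := Equiv.sumCompl fun n => n ∈ Z
  let w : Fin N → ℝ := Sum.elim u y ∘ e.symm
  have hwe : w ∘ e = Sum.elim u y := by ext i; simp [w]
  have hQe : Q.submatrix e e = fromBlocks A B Bᴴ D := by
    rw [← hBt]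
    ext (i | i) (j | j) <;> rfl
  have hquad : w ⬝ᵥ Q.mulVec w = u ⬝ᵥ (schurCompl Q Z).mulVec u := by
    have h1 : w ⬝ᵥ Q.mulVec w = (w ∘ e) ⬝ᵥ (Q.submatrix e e).mulVec (w ∘ e) := by
      have hw : (w ∘ e) ∘ e.symm = w := by ext; simp
      rw [submatrix_mulVec_equiv, hw, comp_equiv_dotProduct_comp_equiv]
    have h2 := schur_complement_eq₂₂ A B u y hDpos.1
    rw [h1, hwe, hQe, dotProduct_mulVec, hS, dotProduct_mulVec]
    simpa [y] using h2
  refine ⟨w + c, ?_, fun n hn => ?_⟩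
  · rw [Feasible, add_sub_cancel_right, hquad]
    refine (dotProduct_mulVec_le_lambdaMax hSh u).trans (le_of_eq_of_le ?_ h)
    rw [← Finset.sum_coe_sort]
    congr 1
    exact Finset.sum_congr rfl fun n _ => by simp [u]; ring
  · have : e.symm n = Sum.inl ⟨n, hn⟩ := by simp [e, hn]
    simp [w, this, u]

lemma monotone_sq_comp {c : Fin N → ℝ} {σ : Equiv.Perm (Fin N)}
    (hσ : Monotone fun i => |c (σ i)|) : Monotone ((fun n => c n ^ 2) ∘ σ) :=
  fun _ _ hij => sq_le_sq.2 (hσ hij)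

lemma schurK_le_maxZeros {Q : Matrix (Fin N) (Fin N) ℝ} (hQ : Q.PosDef) {c : Fin N → ℝ} {γ : ℝ}
    (hγ : 0 ≤ γ) {σ : Equiv.Perm (Fin N)} (hσ : Monotone fun i => |c (σ i)|) :
    schurK Q c γ σ ≤ maxZeros Q c γ := by
  have hmem : schurK Q c γ σ ∈ {K : ℕ | K ≤ N ∧
      lambdaMax (schurCompl Q (firstIdx σ K)) * sumSmallest K (fun n => c n ^ 2) ≤ γ} :=
    Nat.sSup_mem ⟨0, by simpa [sumSmallest] using hγ⟩ ⟨N, fun K hK => hK.1⟩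
  obtain ⟨hKN, hK⟩ := hmem
  rw [sumSmallest_eq_sum_firstIdx (monotone_sq_comp hσ)] at hK
  obtain ⟨x, hx, hx0⟩ := exists_feasible_schurCompl hQ _ c hK
  simpa only [card_firstIdx σ hKN] using card_le_maxZeros hx hx0
lemma bddAbove_meanK (lam c : Fin N → ℝ) (γ ε : ℝ) : BddAbove {K : ℕ | K ≤ N ∧
    (1 + ε) * eigMean lam * sumSmallest K (fun n => c n ^ 2) ≤ γ} :=
  ⟨N, fun _ hK => hK.1⟩

lemma meanK_spec (lam c : Fin N → ℝ) {γ : ℝ} (ε : ℝ) (hγ : 0 ≤ γ) :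
    meanK lam c γ ε ≤ N ∧
      (1 + ε) * eigMean lam * sumSmallest (meanK lam c γ ε) (fun n => c n ^ 2) ≤ γ :=
  Nat.sSup_mem (s := {K : ℕ | K ≤ N ∧
    (1 + ε) * eigMean lam * sumSmallest K (fun n => c n ^ 2) ≤ γ})
    ⟨0, by simpa [sumSmallest] using hγ⟩ (bddAbove_meanK lam c γ ε)

lemma lt_of_meanK_lt (lam c : Fin N → ℝ) (γ ε : ℝ) (h : meanK lam c γ ε < N) :
    γ < (1 + ε) * eigMean lam * sumSmallest (meanK lam c γ ε + 1) (fun n => c n ^ 2) := by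
  by_contra! hle
  exact (Nat.lt_succ_self _).not_ge (le_csSup (bddAbove_meanK lam c γ ε) ⟨h, hle⟩)

/-- The vector supported on the `K` first indices of `σ`, where it agrees with `c`. -/
def truncate (σ : Equiv.Perm (Fin N)) (K : ℕ) (c : Fin N → ℝ) : Fin N → ℝ :=
  fun n => if n ∈ firstIdx σ K then c n else 0

lemma sum_sq_truncate {c : Fin N → ℝ} {σ : Equiv.Perm (Fin N)}
    (hσ : Monotone fun i => |c (σ i)|) (K : ℕ) :
    ∑ n, truncate σ K c n ^ 2 = sumSmallest K fun n => c n ^ 2 := by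
  rw [sumSmallest_eq_sum_firstIdx (monotone_sq_comp hσ)]
  simp [truncate, ite_pow]

lemma meanK_le_maxZeros {Q : Matrix (Fin N) (Fin N) ℝ} {lam c : Fin N → ℝ} {γ ε : ℝ} (hγ : 0 ≤ γ)
    {σ : Equiv.Perm (Fin N)} (hσ : Monotone fun i => |c (σ i)|)
    (hE : truncate σ (meanK lam c γ ε) c ⬝ᵥ Q.mulVec (truncate σ (meanK lam c γ ε) c) ≤
      (1 + ε) * eigMean lam * ∑ n, truncate σ (meanK lam c γ ε) c n ^ 2) :
    meanK lam c γ ε ≤ maxZeros Q c γ := by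
  obtain ⟨hKN, hK⟩ := meanK_spec lam c ε hγ
  set K := meanK lam c γ ε
  rw [sum_sq_truncate hσ] at hE
  have hx : Feasible Q c γ (c - truncate σ K c) := by
    rw [Feasible, sub_sub_cancel_left, mulVec_neg, neg_dotProduct_neg]
    exact hE.trans hK
  have := card_le_maxZeros hx (Z := firstIdx σ K) fun n hn => by simp [truncate, hn]
  rwa [card_firstIdx σ hKN] at this

/-- The deterministic part: the three bounds on the approximation ratio hold as soon as the
quadratic form of `Q` at the truncation of `c` does not exceed its mean by more than the
factor `1 + ε`. -/
theorem ratio_bounds {V : Matrix (Fin N) (Fin N) ℝ} (hV : V ∈ orthogonalGroup (Fin N) ℝ)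
    (hN : 0 < N) {lam : Fin N → ℝ} (hlam : ∀ n, 0 < lam n) {c : Fin N → ℝ} {γ ε : ℝ} (hγ : 0 ≤ γ)
    (hε : 0 ≤ ε) {σ : Equiv.Perm (Fin N)} (hσ : Monotone fun i => |c (σ i)|)
    (hE : truncate σ (meanK lam c γ ε) c ⬝ᵥ
        (ofEigen V lam).mulVec (truncate σ (meanK lam c γ ε) c) ≤
      (1 + ε) * eigMean lam * ∑ n, truncate σ (meanK lam c γ ε) c n ^ 2) :
    let Q := ofEigen V lam
    let Kstar := maxZeros Q c γ
    let Kd := diagMaxZeros Q c γ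
    let K := meanK lam c γ ε
    let K' := schurK Q c γ σ
    (0 < K → 0 < Kstar ∧ (Kd : ℝ) / (Kstar : ℝ) ≤ ratioBound lam ε K) ∧
      (0 < K' → 0 < Kstar ∧
        (K ≤ K' → (Kd : ℝ) / (Kstar : ℝ) ≤ ratioBound lam ε K') ∧
        (Kd : ℝ) / (Kstar : ℝ) <
          ((K' : ℝ) + 1) * (1 + ε) * eigMean lam / eigMin lam / (K' : ℝ)) := by
  intro Q Kstar Kd K K'
  have hμ := eigMin_pos hN hlam
  have hmean : eigMin lam ≤ eigMean lam := eigMin_le_eigMean hN lam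
  have hq : eigMin lam ≤ (1 + ε) * eigMean lam := by nlinarith
  have hK : K ≤ Kstar := meanK_le_maxZeros hγ hσ hE
  have hK' : K' ≤ Kstar := schurK_le_maxZeros (posDef_ofEigen hV hlam) hγ hσ
  set r : ℝ := (1 + ε) * eigMean lam / eigMin lam with hr
  have hr0 : 0 < r := div_pos (hμ.trans_le hq) hμ
  have hform : ∀ M : ℕ, ((M : ℝ) + 1) * (1 + ε) * eigMean lam / eigMin lam = (M + 1) * r :=
    fun M => by rw [hr]; ring
  have hKd : (Kd : ℝ) < ((K : ℝ) + 1) * r :=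
    calc (Kd : ℝ) ≤ (maxZeros (diagonal fun _ : Fin N => eigMin lam) c γ : ℝ) := by
          exact_mod_cast diagMaxZeros_le hV hN hlam c γ
      _ < _ := maxZeros_diagonal_const_lt hγ hμ hq (lt_of_meanK_lt lam c γ ε)
      _ = _ := by rw [mul_div_assoc]
  have hstep : ∀ M : ℕ, 0 < M → M ≤ Kstar → (Kd : ℝ) < ((M : ℝ) + 1) * r →
      (Kd : ℝ) / Kstar ≤ ratioBound lam ε M := by
    intro M hM hMs hlt
    have hM0 : (0 : ℝ) < M := by exact_mod_cast hM
    have hceil : ((Kd : ℤ) : ℝ) ≤ ((⌈((M : ℝ) + 1) * r⌉ - 1 : ℤ) : ℝ) :=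
      Int.cast_le.2 (Int.le_sub_one_of_lt (Int.lt_ceil.2 (by exact_mod_cast hlt)))
    push_cast at hceil
    rw [ratioBound, hform]
    calc (Kd : ℝ) / Kstar ≤ Kd / M :=
          div_le_div_of_nonneg_left (Nat.cast_nonneg _) hM0 (by exact_mod_cast hMs)
      _ ≤ _ := div_le_div_of_nonneg_right hceil hM0.le
  refine ⟨fun h => ⟨h.trans_le hK, hstep K h hK hKd⟩, fun h => ⟨h.trans_le hK', fun hKK => ?_, ?_⟩⟩
  · exact hstep K' h hK' (hKd.trans_le (by gcongr))
  · have h0 : (0 : ℝ) < K' := by exact_mod_cast h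
    have hs : (0 : ℝ) < Kstar := by exact_mod_cast h.trans_le hK'
    rw [hform, div_lt_div_iff₀ hs h0]
    rcases le_total K K' with hKK | hKK
    · have h1 : (K' : ℝ) ≤ Kstar := by exact_mod_cast hK'
      calc (Kd : ℝ) * K' < (K + 1) * r * K' := mul_lt_mul_of_pos_right hKd h0
        _ ≤ (K' + 1) * r * Kstar := by gcongr
    · have h1 : (K : ℝ) ≤ Kstar := by exact_mod_cast hK
      have h2 : (K' : ℝ) ≤ K := by exact_mod_cast hKK
      calc (Kd : ℝ) * K' < (K + 1) * r * K' := mul_lt_mul_of_pos_right hKd h0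
        _ = r * ((K + 1) * K') := by ring
        _ ≤ r * ((K' + 1) * K) := by gcongr 1 ; nlinarith
        _ = (K' + 1) * r * K := by ring
        _ ≤ (K' + 1) * r * Kstar := by gcongr

/-! ### Averaging over the orthogonal group -/

/-- The standard Gaussian law is invariant under rotations. -/
lemma map_mulVec_pi_gaussianReal {W : Matrix (Fin N) (Fin N) ℝ}
    (hW : W ∈ orthogonalGroup (Fin N) ℝ) :
    (Measure.pi fun _ : Fin N => gaussianReal 0 1).map (fun g => W.mulVec g) =
      Measure.pi fun _ : Fin N => gaussianReal 0 1 := by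
  have hW' : Wᵀ * W = 1 := (mem_orthogonalGroup_iff' (Fin N) ℝ).1 hW
  let f : EuclideanSpace ℝ (Fin N) →ₗᵢ[ℝ] EuclideanSpace ℝ (Fin N) :=
    { toEuclideanLin W with
      norm_map' := fun x => by
        have h : (W *ᵥ x.ofLp) ⬝ᵥ (W *ᵥ x.ofLp) = x.ofLp ⬝ᵥ x.ofLp := by
          rw [dotProduct_mulVec, vecMul_mulVec, ← dotProduct_mulVec, hW', one_mulVec]
        rw [EuclideanSpace.norm_eq, EuclideanSpace.norm_eq]
        simp only [dotProduct] at h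
        simp only [Real.norm_eq_abs, sq_abs]
        congr 1
        simpa [sq] using h }
  let e := f.toLinearIsometryEquiv rfl
  have he : ∀ g : Fin N → ℝ, e (WithLp.toLp 2 g) = WithLp.toLp 2 (W *ᵥ g) := fun g => by
    simp [e, f]
  have hmeas : Measurable fun g : Fin N → ℝ => W *ᵥ g :=
    (Continuous.matrix_mulVec continuous_const continuous_id).measurable
  have h := stdGaussian_map e
  rw [← map_pi_eq_stdGaussian, Measure.map_map e.continuous.measurable (by fun_prop)] at h
  have h2 := congrArg (fun μ => μ.map (WithLp.ofLp : EuclideanSpace ℝ (Fin N) → Fin N → ℝ)) h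
  simp only at h2
  rw [Measure.map_map (by fun_prop) (e.continuous.measurable.comp (by fun_prop)),
    Measure.map_map (by fun_prop) (by fun_prop)] at h2
  have hcomp : WithLp.ofLp ∘ e ∘ WithLp.toLp 2 = fun g : Fin N → ℝ => W *ᵥ g := by
    funext g
    simp [he]
  have hid : (WithLp.ofLp : EuclideanSpace ℝ (Fin N) → _) ∘ WithLp.toLp 2 = id := rfl
  rwa [hcomp, hid, Measure.map_id] at h2

/-- The orthogonal group acts transitively on spheres. -/
lemma exists_orthogonal_mulVec_eq {u v : Fin N → ℝ} (h : u ⬝ᵥ u = v ⬝ᵥ v) :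
    ∃ U ∈ orthogonalGroup (Fin N) ℝ, U *ᵥ u = v := by
  rcases eq_or_ne u v with rfl | huv
  · exact ⟨1, one_mem _, one_mulVec u⟩
  -- The Householder reflection along `u - v`.
  obtain ⟨z, hz⟩ : ∃ z, z = u - v := ⟨_, rfl⟩
  have hz0 : z ⬝ᵥ z ≠ 0 := fun h0 =>
    huv (sub_eq_zero.1 (hz ▸ dotProduct_self_eq_zero.1 h0))
  have hzu : 2 * (z ⬝ᵥ u) = z ⬝ᵥ z := by
    simp only [hz, sub_dotProduct, dotProduct_sub]
    rw [dotProduct_comm v u]; linarith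
  set H : Matrix (Fin N) (Fin N) ℝ := 1 - (2 / (z ⬝ᵥ z)) • vecMulVec z z with hH
  have hHt : Hᵀ = H := by simp [hH, transpose_vecMulVec]
  have hHv : ∀ x, H *ᵥ x = x - (2 / (z ⬝ᵥ z) * (z ⬝ᵥ x)) • z := fun x => by
    rw [hH, sub_mulVec, one_mulVec, smul_mulVec, vecMulVec_mulVec, op_smul_eq_smul, smul_smul]
  refine ⟨H, (mem_orthogonalGroup_iff (Fin N) ℝ).2 ?_, ?_⟩
  · rw [hHt]
    refine ext_of_mulVec_single fun i => ?_
    rw [← mulVec_mulVec, hHv, hHv, one_mulVec, dotProduct_sub, dotProduct_smul, sub_sub, ← add_smul]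
    have : 2 / (z ⬝ᵥ z) * (z ⬝ᵥ Pi.single i 1) +
        2 / (z ⬝ᵥ z) * (z ⬝ᵥ Pi.single i 1 - (2 / (z ⬝ᵥ z) * (z ⬝ᵥ Pi.single i 1)) • (z ⬝ᵥ z)) =
        0 := by
      rw [smul_eq_mul]; field_simp; ring
    rw [this, zero_smul, sub_zero]
  · rw [hHv, div_mul_eq_mul_div, hzu, div_self hz0, one_smul, hz, sub_sub_cancel]

section Haar

variable {Ω : Type*} [MeasurableSpace Ω] {P : Measure Ω} {V : Ω → Matrix (Fin N) (Fin N) ℝ}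

lemma IsHaarOrthogonal.measurable_transpose_mulVec (hV : IsHaarOrthogonal P V) :
    Measurable fun p : Ω × (Fin N → ℝ) => (V p.1)ᵀ *ᵥ p.2 := by
  refine measurable_pi_lambda _ fun n => ?_
  simp only [mulVec, dotProduct, transpose_apply]
  exact Finset.measurable_sum _ fun i _ =>
    ((hV.measurable i n).comp measurable_fst).mul ((measurable_pi_apply i).comp measurable_snd)

/-- The law of `Vᵀ u` depends on `u` only up to rotation. -/
lemma IsHaarOrthogonal.measure_transpose_mulVec_mem (hV : IsHaarOrthogonal P V)
    {U : Matrix (Fin N) (Fin N) ℝ} (hU : U ∈ orthogonalGroup (Fin N) ℝ) (u : Fin N → ℝ)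
    {s : Set (Fin N → ℝ)} (hs : MeasurableSet s) :
    P {ω | (V ω)ᵀ *ᵥ (U *ᵥ u) ∈ s} = P {ω | (V ω)ᵀ *ᵥ u ∈ s} := by
  have hUt : Uᵀ ∈ orthogonalGroup (Fin N) ℝ := by
    have := (mem_orthogonalGroup_iff' (Fin N) ℝ).1 hU
    exact (mem_orthogonalGroup_iff (Fin N) ℝ).2 (by rwa [transpose_transpose])
  have hT : MeasurableSet {M : Fin N → Fin N → ℝ | (of M)ᵀ *ᵥ u ∈ s} := by
    refine hs.preimage ?_
    refine measurable_pi_lambda _ fun n => ?_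
    simp only [mulVec, dotProduct, transpose_apply, of_apply]
    fun_prop
  have hm : Measurable fun ω => fun i j : Fin N => V ω i j :=
    measurable_pi_lambda _ fun i => measurable_pi_lambda _ fun j => hV.measurable i j
  have hm' : Measurable fun ω => fun i j : Fin N => (Uᵀ * V ω) i j :=
    measurable_pi_lambda _ fun i => measurable_pi_lambda _ fun j => by
      simp only [mul_apply]
      exact Finset.measurable_sum _ fun k _ => (hV.measurable k j).const_mul _
  have h := congrArg (fun μ => μ {M : Fin N → Fin N → ℝ | (of M)ᵀ *ᵥ u ∈ s}) (hV.invariant _ hUt)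
  simp only [Measure.map_apply hm hT, Measure.map_apply hm' hT] at h
  refine Eq.trans (congrArg P ?_) h
  ext ω
  have h2 : (of fun i j => (Uᵀ * V ω) i j)ᵀ *ᵥ u = (V ω)ᵀ *ᵥ (U *ᵥ u) := by
    rw [mulVec_mulVec, show (of fun i j => (Uᵀ * V ω) i j) = Uᵀ * V ω from rfl, transpose_mul,
      transpose_transpose]
  exact iff_of_eq (by rw [Set.mem_preimage, Set.mem_ofPred_eq, Set.mem_ofPred_eq, h2])

/-- The sign of the quadratic form `∑ aₙ xₙ²` at `Vᵀ u`, which up to scaling is a uniform point of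
the sphere, has the same law as its sign at a standard Gaussian vector. Both are computed as a
probability under the product of the law of `V` and the Gaussian law. -/
lemma IsHaarOrthogonal.measure_quadForm_pos_eq [IsProbabilityMeasure P]
    (hV : IsHaarOrthogonal P V) (hN : 0 < N) (a : Fin N → ℝ) {u : Fin N → ℝ} (hu : u ≠ 0) :
    P {ω | 0 < ∑ n, a n * ((V ω)ᵀ *ᵥ u) n ^ 2} =
      (Measure.pi fun _ : Fin N => gaussianReal 0 1) {g | 0 < ∑ n, a n * g n ^ 2} := by
  set G := Measure.pi fun _ : Fin N => gaussianReal 0 1 with hG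
  set s : Set (Fin N → ℝ) := {w | 0 < ∑ n, a n * w n ^ 2} with hs_def
  have hs : MeasurableSet s := measurableSet_lt measurable_const (by fun_prop)
  have hscale : ∀ (t : ℝ), t ≠ 0 → ∀ w : Fin N → ℝ, t • w ∈ s ↔ w ∈ s := by
    intro t ht w
    have : ∑ n, a n * (t • w) n ^ 2 = t ^ 2 * ∑ n, a n * w n ^ 2 := by
      rw [Finset.mul_sum]
      exact Finset.sum_congr rfl fun n _ => by simp only [Pi.smul_apply, smul_eq_mul]; ring
    rw [hs_def, Set.mem_ofPred_eq, Set.mem_ofPred_eq, this]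
    exact mul_pos_iff_of_pos_left (by positivity)
  have hconst : ∀ g : Fin N → ℝ, g ≠ 0 →
      P {ω | (V ω)ᵀ *ᵥ g ∈ s} = P {ω | (V ω)ᵀ *ᵥ u ∈ s} := by
    intro g hg
    have hpos : ∀ x : Fin N → ℝ, x ≠ 0 → 0 < x ⬝ᵥ x := fun x hx =>
      lt_of_le_of_ne (Finset.sum_nonneg fun i _ => mul_self_nonneg _)
        (Ne.symm fun h0 => hx (dotProduct_self_eq_zero.1 h0))
    have hgg := hpos g hg
    have huu := hpos u hu
    set t := √(g ⬝ᵥ g / (u ⬝ᵥ u)) with ht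
    have ht0 : t ≠ 0 := (Real.sqrt_pos.2 (div_pos hgg huu)).ne'
    obtain ⟨U, hU, hUg⟩ := exists_orthogonal_mulVec_eq (u := t • u) (v := g) (by
      rw [smul_dotProduct, dotProduct_smul, smul_smul, ht, Real.mul_self_sqrt (by positivity),
        smul_eq_mul, div_mul_cancel₀ _ huu.ne'])
    rw [← hUg, hV.measure_transpose_mulVec_mem hU _ hs]
    refine congrArg P (Set.ext fun ω => ?_)
    simp only [Set.mem_ofPred_eq, mulVec_smul]
    exact hscale t ht0 _
  have hprod : MeasurableSet {p : Ω × (Fin N → ℝ) | (V p.1)ᵀ *ᵥ p.2 ∈ s} :=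
    hs.preimage hV.measurable_transpose_mulVec
  have h1 : (P.prod G) {p : Ω × (Fin N → ℝ) | (V p.1)ᵀ *ᵥ p.2 ∈ s} = G s := by
    rw [Measure.prod_apply hprod]
    have : ∀ ω, G (Prod.mk ω ⁻¹' {p : Ω × (Fin N → ℝ) | (V p.1)ᵀ *ᵥ p.2 ∈ s}) = G s := by
      intro ω
      have hVt : (V ω)ᵀ ∈ orthogonalGroup (Fin N) ℝ :=
        (mem_orthogonalGroup_iff' (Fin N) ℝ).2 (by
          rw [transpose_transpose]; exact (mem_orthogonalGroup_iff (Fin N) ℝ).1 (hV.mem ω))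
      conv_rhs => rw [hG, ← map_mulVec_pi_gaussianReal hVt]
      have hmeas : Measurable fun g : Fin N → ℝ => (V ω)ᵀ *ᵥ g :=
        (Continuous.matrix_mulVec continuous_const continuous_id).measurable
      rw [Measure.map_apply hmeas hs]
      rfl
    rw [lintegral_congr this, lintegral_const, measure_univ, mul_one]
  have h2 : (P.prod G) {p : Ω × (Fin N → ℝ) | (V p.1)ᵀ *ᵥ p.2 ∈ s} =
      P {ω | (V ω)ᵀ *ᵥ u ∈ s} := by
    rw [Measure.prod_apply_symm hprod]
    have hae : ∀ᵐ g ∂G, P ((fun ω => (ω, g)) ⁻¹' {p : Ω × (Fin N → ℝ) | (V p.1)ᵀ *ᵥ p.2 ∈ s}) =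
        P {ω | (V ω)ᵀ *ᵥ u ∈ s} := by
      have h0 : G {0} = 0 := by
        have : NullSingletonClass (gaussianReal 0 1) := nullSingletonClass_gaussianReal one_ne_zero
        rw [hG, Measure.pi_singleton]
        exact Finset.prod_eq_zero (Finset.mem_univ ⟨0, hN⟩) (measure_singleton _)
      filter_upwards [compl_mem_ae_iff.2 h0] with g hg
      exact hconst g hg
    rw [lintegral_congr_ae hae]
    simp
  exact h2.symm.trans h1

end Haar

/-! ### Chernoff bound for Gaussian quadratic forms -/

lemma exp_neg_add_sq_le {x : ℝ} (hx : x ≤ 1 / 2) : Real.exp (-(x + x ^ 2)) ≤ 1 - x := by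
  rw [Real.exp_neg]
  refine inv_le_of_inv_le₀ (by linarith) ?_
  rw [inv_le_iff_one_le_mul₀ (by linarith)]
  rcases le_total 0 x with h0 | h0
  · have h1 := Real.quadratic_le_exp_of_nonneg (x := x + x ^ 2) (by positivity)
    refine le_trans ?_ (mul_le_mul_of_nonneg_right h1 (by linarith))
    have h2 : 0 ≤ 1 - x - x ^ 2 - x ^ 3 := by
      nlinarith [mul_nonneg h0 (sub_nonneg.2 hx), mul_nonneg (sq_nonneg x) (sub_nonneg.2 hx)]
    have h3 : (1 + (x + x ^ 2) + (x + x ^ 2) ^ 2 / 2) * (1 - x) =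
      1 + x ^ 2 * (1 - x - x ^ 2 - x ^ 3) / 2 := by ring
    rw [h3]
    have := mul_nonneg (sq_nonneg x) h2
    linarith
  · have h1 := Real.add_one_le_exp (x + x ^ 2)
    refine le_trans ?_ (mul_le_mul_of_nonneg_right h1 (by linarith))
    nlinarith [mul_nonneg (sq_nonneg x) (neg_nonneg.2 h0)]

lemma gaussianPDFReal_mul_exp_sq (s x : ℝ) : gaussianPDFReal 0 1 x * Real.exp (s * x ^ 2) =
    (√(2 * Real.pi))⁻¹ * Real.exp (-(1 / 2 - s) * x ^ 2) := by
  rw [gaussianPDFReal, mul_assoc, ← Real.exp_add]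
  simp only [NNReal.coe_one, mul_one, sub_zero]
  congr 2
  ring

lemma integrable_exp_mul_sq_gaussianReal {s : ℝ} (hs : s < 1 / 2) :
    Integrable (fun x => Real.exp (s * x ^ 2)) (gaussianReal 0 1) := by
  rw [gaussianReal_of_var_ne_zero 0 one_ne_zero, integrable_withDensity_iff_integrable_smul'
    (measurable_gaussianPDF 0 1) (ae_of_all _ fun _ => gaussianPDF_lt_top)]
  simp only [toReal_gaussianPDF, smul_eq_mul, gaussianPDFReal_mul_exp_sq]
  exact (integrable_exp_neg_mul_sq (by linarith)).const_mul _

lemma integral_exp_mul_sq_gaussianReal_le {s : ℝ} (hs : s ≤ 1 / 4) :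
    ∫ x, Real.exp (s * x ^ 2) ∂gaussianReal 0 1 ≤ Real.exp (s + 2 * s ^ 2) := by
  rw [integral_gaussianReal_eq_integral_smul one_ne_zero]
  simp only [smul_eq_mul, gaussianPDFReal_mul_exp_sq]
  rw [integral_const_mul, integral_gaussian, ← Real.sqrt_inv, ← Real.sqrt_mul (by positivity)]
  have h0 : (0 : ℝ) < 1 - 2 * s := by linarith
  refine Real.sqrt_le_iff.2 ⟨(Real.exp_pos _).le, ?_⟩
  have h1 := exp_neg_add_sq_le (x := 2 * s) (by linarith)
  have h2 : (2 * Real.pi)⁻¹ * (Real.pi / (1 / 2 - s)) = (1 - 2 * s)⁻¹ := by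
    have : (1 / 2 - s) ≠ 0 := by linarith
    field_simp
  rw [h2, ← Real.exp_nat_mul]
  refine inv_le_of_inv_le₀ (Real.exp_pos _) ?_
  rw [← Real.exp_neg]
  refine le_of_eq_of_le ?_ h1
  congr 1
  push_cast
  ring

lemma gaussian_quadForm_pos_le (a : Fin N → ℝ) {t : ℝ} (ht : 0 ≤ t) (hta : ∀ n, t * a n ≤ 1 / 4) :
    (Measure.pi fun _ : Fin N => gaussianReal 0 1).real {g | 0 < ∑ n, a n * g n ^ 2} ≤
      Real.exp (t * ∑ n, a n + 2 * t ^ 2 * ∑ n, a n ^ 2) := by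
  set G := Measure.pi fun _ : Fin N => gaussianReal 0 1 with hG
  have hexp : ∀ g : Fin N → ℝ, Real.exp (t * ∑ n, a n * g n ^ 2) =
      ∏ n, Real.exp (t * a n * g n ^ 2) := fun g => by
    rw [← Real.exp_sum, Finset.mul_sum]
    simp only [mul_assoc]
  have hint : Integrable (fun g => Real.exp (t * ∑ n, a n * g n ^ 2)) G := by
    simp only [hexp]
    exact Integrable.fintype_prod (f := fun n x => Real.exp (t * a n * x ^ 2)) fun n =>
      integrable_exp_mul_sq_gaussianReal (by linarith [hta n])
  calc G.real {g | 0 < ∑ n, a n * g n ^ 2}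
      ≤ G.real {g | 0 ≤ ∑ n, a n * g n ^ 2} := measureReal_mono (Set.ofPred_subset_ofPred.2 fun g hg => le_of_lt hg)
    _ ≤ Real.exp (-t * 0) * mgf (fun g : Fin N → ℝ => ∑ n, a n * g n ^ 2) G t :=
        measure_ge_le_exp_mul_mgf 0 ht hint
    _ = ∏ n, ∫ x, Real.exp (t * a n * x ^ 2) ∂gaussianReal 0 1 := by
        rw [mul_zero, Real.exp_zero, one_mul, mgf]
        simp only [hexp]
        exact integral_fintype_prod_eq_prod (fun n x => Real.exp (t * a n * x ^ 2))
    _ ≤ ∏ n, Real.exp (t * a n + 2 * (t * a n) ^ 2) :=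
        Finset.prod_le_prod (fun n _ => integral_nonneg fun x => (Real.exp_pos _).le)
          fun n _ => integral_exp_mul_sq_gaussianReal_le (hta n)
    _ = _ := by
        rw [← Real.exp_sum, Finset.sum_add_distrib, Finset.mul_sum, Finset.mul_sum]
        congr 2
        exact Finset.sum_congr rfl fun n _ => by ring

/-! ### Concentration of the quadratic form -/

lemma probBound_le_one (lam : Fin N → ℝ) (ε : ℝ) : probBound lam ε ≤ 1 := by
  unfold probBound
  split_ifs
  · exact le_rfl
  all_goals exact sub_le_self _ (Real.exp_pos _).le

lemma eigVar_nonneg (lam : Fin N → ℝ) : 0 ≤ eigVar lam :=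
  mul_nonneg (by positivity) (Finset.sum_nonneg fun _ _ => sq_nonneg _)

lemma sum_sub_shift (hN : 0 < N) (lam : Fin N → ℝ) (ε : ℝ) :
    ∑ n, (lam n - (1 + ε) * eigMean lam) = -(N * (ε * eigMean lam)) := by
  rw [Finset.sum_sub_distrib, sum_eq_card_mul_eigMean hN lam, Finset.sum_const, Finset.card_fin,
    nsmul_eq_mul]
  ring

lemma sum_sq_sub_shift (hN : 0 < N) (lam : Fin N → ℝ) (ε : ℝ) :
    ∑ n, (lam n - (1 + ε) * eigMean lam) ^ 2 =
      N * (ε ^ 2 * eigMean lam ^ 2 + eigVar lam) := by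
  have h1 : ∑ n, (lam n - eigMean lam) = 0 := by
    have := sum_sub_shift hN lam 0
    simpa using this
  have h2 : ∑ n, (lam n - eigMean lam) ^ 2 = N * eigVar lam := by
    rw [eigVar]; field_simp
  have h3 : ∀ n, (lam n - (1 + ε) * eigMean lam) ^ 2 = (lam n - eigMean lam) ^ 2 -
      2 * (ε * eigMean lam) * (lam n - eigMean lam) + (ε * eigMean lam) ^ 2 := fun n => by ring
  simp only [h3, Finset.sum_add_distrib, Finset.sum_sub_distrib (f := fun n =>
    (lam n - eigMean lam) ^ 2), ← Finset.mul_sum, h1, h2, Finset.sum_const, Finset.card_fin,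
    nsmul_eq_mul]
  ring

/-- The interval `𝓘` consists of the `ε` violating
`(max aₙ) · (-mean of aₙ) ≤ mean of aₙ²`, where `aₙ = λₙ - (1 + ε) · mean`, that is, of those for
which the optimal Chernoff parameter is too large. -/
lemma mem_epsInterval_iff {lam : Fin N → ℝ} (hmean : 0 < eigMean lam) (ε : ℝ) :
    ε ∈ epsInterval lam ↔ ε ^ 2 * eigMean lam ^ 2 + eigVar lam <
      ε * eigMean lam * (eigMax lam - (1 + ε) * eigMean lam) := by
  set m := eigMean lam
  set M := eigMax lam
  set v := eigVar lam
  have he : epsMax lam = (M - m) / m := by rw [epsMax, sub_div, div_self hmean.ne']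
  set s := epsMax lam ^ 2 - 8 * (v / m ^ 2) with hs
  have hsm : s * m ^ 2 = (M - m) ^ 2 - 8 * v := by rw [hs, he]; field_simp
  have hlt : ε ∈ Set.Ioo (epsMinus lam) (epsPlus lam) ↔ |4 * ε - epsMax lam| < √s := by
    rw [abs_lt, Set.mem_Ioo, epsMinus, epsPlus]
    constructor <;> rintro ⟨h1, h2⟩ <;> constructor <;> linarith
  have hsq : |4 * ε - epsMax lam| < √s ↔ ε ^ 2 * m ^ 2 + v < ε * m * (M - (1 + ε) * m) := by
    rw [Real.lt_sqrt (abs_nonneg _), sq_abs, ← mul_lt_mul_iff_of_pos_right (pow_pos hmean 2), hsm]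
    have : (4 * ε - epsMax lam) ^ 2 * m ^ 2 = (4 * (ε * m) - (M - m)) ^ 2 := by
      rw [he]; field_simp
    rw [this]
    constructor <;> intro h <;> nlinarith
  unfold epsInterval
  split_ifs with h
  · rw [hlt, hsq]
  · refine iff_of_false (Set.notMem_empty _) fun h' => h ?_
    nlinarith [sq_nonneg (4 * (ε * m) - (M - m))]

/-- For every fixed vector `u`, the quadratic form `uᵀ Q u` is at most `(1 + ε) · mean · ‖u‖²` with
at least the guaranteed probability. -/
theorem probBound_le_measureReal {Ω : Type*} [MeasurableSpace Ω] {P : Measure Ω}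
    [IsProbabilityMeasure P] {V : Ω → Matrix (Fin N) (Fin N) ℝ} (hV : IsHaarOrthogonal P V)
    (hN : 0 < N) {lam : Fin N → ℝ} (hlam : ∀ n, 0 < lam n) {ε : ℝ} (hε : 0 < ε)
    (u : Fin N → ℝ) :
    probBound lam ε ≤ P.real {ω | u ⬝ᵥ (ofEigen (V ω) lam).mulVec u ≤
      (1 + ε) * eigMean lam * ∑ n, u n ^ 2} := by
  have hmean : 0 < eigMean lam := (eigMin_pos hN hlam).trans_le (eigMin_le_eigMean hN lam)
  set m := eigMean lam with hm
  let a : Fin N → ℝ := fun n => lam n - (1 + ε) * m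
  have hdiff : ∀ ω, u ⬝ᵥ (ofEigen (V ω) lam).mulVec u - (1 + ε) * m * ∑ n, u n ^ 2 =
      ∑ n, a n * ((V ω)ᵀ *ᵥ u) n ^ 2 := fun ω => by
    rw [ofEigen_quadForm, ← sum_sq_transpose_mulVec (hV.mem ω) u, Finset.mul_sum,
      ← Finset.sum_sub_distrib]
    exact Finset.sum_congr rfl fun n _ => by simp only [a]; ring
  set E := {ω | u ⬝ᵥ (ofEigen (V ω) lam).mulVec u ≤ (1 + ε) * m * ∑ n, u n ^ 2} with hE_def
  have hE : ∀ ω, ω ∈ E ↔ ∑ n, a n * ((V ω)ᵀ *ᵥ u) n ^ 2 ≤ 0 := fun ω => by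
    rw [← hdiff, sub_nonpos, hE_def, Set.mem_ofPred_eq]
  have hsure : (∀ ω, ω ∈ E) → probBound lam ε ≤ P.real E := fun h => by
    rw [Set.eq_univ_of_forall h, probReal_univ]
    exact probBound_le_one lam ε
  rcases eq_or_ne u 0 with rfl | hu
  · exact hsure fun ω => (hE ω).2 (by simp)
  by_cases hmax : epsMax lam ≤ ε
  · refine hsure fun ω => (hE ω).2 (Finset.sum_nonpos fun n _ =>
      mul_nonpos_of_nonpos_of_nonneg ?_ (sq_nonneg _))
    have h1 : eigMax lam ≤ (1 + ε) * m := by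
      rw [epsMax, sub_le_iff_le_add, div_le_iff₀ hmean] at hmax
      linarith
    linarith [le_eigMax lam n]
  have hApos : 0 < eigMax lam - (1 + ε) * m := by
    rw [not_le, epsMax, lt_sub_iff_add_lt, lt_div_iff₀ hmean] at hmax
    linarith
  set A := eigMax lam - (1 + ε) * m with hA
  have haA : ∀ n, a n ≤ A := fun n => sub_le_sub_right (le_eigMax lam n) _
  have hchernoff : ∀ t : ℝ, 0 ≤ t → t * A ≤ 1 / 4 →
      1 - Real.exp (N * (-(t * (ε * m)) + 2 * t ^ 2 * (ε ^ 2 * m ^ 2 + eigVar lam))) ≤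
        P.real E := by
    intro t ht htA
    have hEm : MeasurableSet E := by
      have hmeas : Measurable fun ω => (V ω)ᵀ *ᵥ u :=
        hV.measurable_transpose_mulVec.comp (measurable_id.prodMk measurable_const)
      have : E = {ω | ∑ n, a n * ((V ω)ᵀ *ᵥ u) n ^ 2 ≤ 0} := Set.ext hE
      rw [this]
      refine measurableSet_le (Finset.measurable_sum _ fun n _ => ?_) measurable_const
      exact (((measurable_pi_apply n).comp hmeas).pow_const 2).const_mul _
    have hcompl : P.real Eᶜ ≤
        Real.exp (N * (-(t * (ε * m)) + 2 * t ^ 2 * (ε ^ 2 * m ^ 2 + eigVar lam))) := by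
      have h1 : Eᶜ = {ω | 0 < ∑ n, a n * ((V ω)ᵀ *ᵥ u) n ^ 2} := by
        ext ω
        rw [Set.mem_compl_iff, hE, not_le, Set.mem_ofPred_eq]
      rw [h1, Measure.real, hV.measure_quadForm_pos_eq hN a hu]
      refine (gaussian_quadForm_pos_le a ht fun n =>
        (mul_le_mul_of_nonneg_left (haA n) ht).trans htA).trans (le_of_eq ?_)
      rw [sum_sub_shift hN lam ε, sum_sq_sub_shift hN lam ε]
      congr 1
      ring
    rw [probReal_compl_eq_one_sub hEm] at hcompl
    linarith
  have hx : 0 < ε * m := mul_pos hε hmean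
  set x := ε * m with hx_def
  have hxx : ε ^ 2 * m ^ 2 = x ^ 2 := by rw [hx_def]; ring
  have hB : 0 < ε ^ 2 * m ^ 2 + eigVar lam := by
    have := eigVar_nonneg lam
    positivity
  have hiff := mem_epsInterval_iff hmean ε
  set B := ε ^ 2 * m ^ 2 + eigVar lam with hB_def
  rw [probBound, if_neg hmax]
  split_ifs with hI
  -- The largest admissible parameter; the stated bound is weaker than the resulting one, which
  -- has `A = λ_max - (1 + ε) · mean` in the denominator.
  · have hBA : B < x * A := hiff.1 hI
    refine le_trans ?_ (hchernoff (1 / (4 * A)) (by positivity) (by field_simp; norm_num))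
    refine sub_le_sub_left (Real.exp_le_exp.2 ?_) 1
    have h1 : -(1 / (4 * A) * x) + 2 * (1 / (4 * A)) ^ 2 * B ≤ -(x / (8 * A)) := by
      have h2 : -(1 / (4 * A) * x) + 2 * (1 / (4 * A)) ^ 2 * B =
          -(x / (8 * A)) + (B - x * A) / (8 * A ^ 2) := by field_simp; ring
      rw [h2]
      have := div_nonpos_of_nonpos_of_nonneg (sub_nonpos.2 hBA.le) (by positivity :
        0 ≤ 8 * A ^ 2)
      linarith
    have h3 : x / (x + (eigMax lam - m)) ≤ x / A :=
      div_le_div_of_nonneg_left hx.le hApos (by rw [hA, add_mul, one_mul]; linarith)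
    calc _ ≤ (N : ℝ) * -(x / (8 * A)) := mul_le_mul_of_nonneg_left h1 (Nat.cast_nonneg _)
      _ = -((N : ℝ) / 8 * (x / A)) := by field_simp
      _ ≤ _ := neg_le_neg (mul_le_mul_of_nonneg_left h3 (by positivity))
  -- The minimizer of `-t x + 2 t² B`.
  · have hBA : x * A ≤ B := not_lt.1 fun h => hI (hiff.2 h)
    refine le_trans ?_ (hchernoff (x / (4 * B)) (by positivity) ?_)
    · refine sub_le_sub_left (Real.exp_le_exp.2 (le_of_eq ?_)) 1
      rw [← hm, ← hB_def, hxx]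
      field_simp
      ring
    · rw [div_mul_eq_mul_div, div_le_div_iff₀ (by positivity) (by norm_num)]
      linarith

end SparseQuad

theorem theorem2 {Ω : Type*} [MeasurableSpace Ω] (P : MeasureTheory.Measure Ω)
    [MeasureTheory.IsProbabilityMeasure P]
    (N : ℕ) (hN : 0 < N)
    (lam : Fin N → ℝ) (hlam : ∀ n, 0 < lam n)
    (c : Fin N → ℝ) (γ : ℝ) (hγ : 0 < γ)
    (V : Ω → Matrix (Fin N) (Fin N) ℝ) (hV : SparseQuad.IsHaarOrthogonal P V)
    (σ : Equiv.Perm (Fin N)) (hσ : Monotone fun i => |c (σ i)|)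
    (ε : ℝ) (hε : 0 < ε) :
    SparseQuad.probBound lam ε ≤ P.real {ω : Ω |
      let Q := SparseQuad.ofEigen (V ω) lam
      let Kstar := SparseQuad.maxZeros Q c γ
      let Kd := SparseQuad.diagMaxZeros Q c γ
      let K := SparseQuad.meanK lam c γ ε
      let K' := SparseQuad.schurK Q c γ σ
      (0 < K → 0 < Kstar ∧
        (Kd : ℝ) / (Kstar : ℝ) ≤ SparseQuad.ratioBound lam ε K) ∧
      (0 < K' → 0 < Kstar ∧
        (K ≤ K' → (Kd : ℝ) / (Kstar : ℝ) ≤ SparseQuad.ratioBound lam ε K') ∧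
        (Kd : ℝ) / (Kstar : ℝ) <
          ((K' : ℝ) + 1) * (1 + ε) * SparseQuad.eigMean lam /
            SparseQuad.eigMin lam / (K' : ℝ))} := by
  refine (SparseQuad.probBound_le_measureReal hV hN hlam hε
    (SparseQuad.truncate σ (SparseQuad.meanK lam c γ ε) c)).trans (measureReal_mono ?_)
  exact Set.ofPred_subset_ofPred.2 fun ω hω =>
    SparseQuad.ratio_bounds (hV.mem ω) hN hlam hγ.le hε.le hσ hω
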